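/- Let $\mathcal G$ be any set and let $A=\{A(i,j)\}_{i,j\in\mathcal G}$ be a matrix with entries in $\{0,1\}$ and no zero rows. *Semigroupoids.* A semigroupoid is a set $\Lambda$ with a subset $\Lambda^{(2)}\subseteq\Lambda\times\Lambda$ and an operation $\Lambda^{(2)}\to\Lambda$, $(f,g)\mapsto fg$, such that whenever (i) $(f,g),(g,h)\in\Lambda^{(2)}$, or (ii) $(f,g),(fg,h)\in\Lambda^{(2)}$, or (iii) $(g,h),(f,gh)\in\Lambda^{(2)}$, then $(f,g),(g,h),(fg,h),(f,gh)\in\Lambda^{(2)}$ and $(fg)h=f(gh)$. One writes $f\mid g$ if $f=g$ or $fh=g$ for some $h$ with $(f,h)\in\Lambda^{(2)}$; $f$ and $g$ intersect if there is $m\in\Lambda$ with $f\mid m$ and $g\mid m$, and otherwise they are disjoint. Put $\Lambda^f=\{g:(f,g)\in\Lambda^{(2)}\}$ for $f\in\Lambda$, let $\tilde\Lambda=\Lambda\,\dot\cup\,\{1\}$ and $\Lambda^1=\Lambda$. For finite $F,G\subseteq\tilde\Lambda$ let $\Lambda^{F,G}=\{h\in\Lambda: h\in\Lambda^f\ \forall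 f\in F,\ h\notin\Lambda^g\ \forall g\in G\}$. A covering of $X\subseteq\Lambda$ is a subset $H\subseteq X$ such that every $f\in X$ intersects some $h\in H$. *Representations.* A representation of $\Lambda$ in a unital C*-algebra $B$ is a map $S:\Lambda\to B$ by partial isometries such that $S_fS_g=S_{fg}$ if $(f,g)\in\Lambda^{(2)}$ and $S_fS_g=0$ otherwise, the projections $Q_f=S_f^*S_f$ and $P_g=S_gS_g^*$ ($f,g\in\Lambda$) all commute with one another, $P_fP_g=0$ if $f$ and $g$ are disjoint, and $Q_fP_g=P_g$ if $(f,g)\in\Lambda^{(2)}$. Put $Q_1=1$. The representation is tight if $$\bigvee_{h\in H}P_h=\prod_{f\in F}Q_f\prod_{g\in G}(1-Q_g)$$ for all finite $F,G\subseteq\tilde\Lambda$ and every finite covering $H$ of $\Lambda^{F,G}$. The algebra $\tilde{\mathcal O}(\Lambda)$ is the universal unital C*-algebra generated by partial isometries $\{S_f\}_{f\in\Lambda}$ subject to the relations that $f\mapsto S_f$ is a tight representation. *The two algebras.* Let $\Lambda_A$ be the Markov semigroupoid: its elements are the words $\alpha_1\cdots\alpha_n$ in $\mathcal G$ with $n\ge1$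 and $A(\alpha_i,\alpha_{i+1})=1$ for $1\le i<n$; the pair $(\alpha_1\cdots\alpha_n,\beta_1\cdots\beta_m)$ is composable iff $A(\alpha_n,\beta_1)=1$, and the product is concatenation. Let $\tilde{\mathcal O}_A$ be the unital Exel–Laca Cuntz–Krieger algebra: the universal unital C*-algebra generated by partial isometries $\{S_x\}_{x\in\mathcal G}$ subject to the following relations, where $Q_x=S_x^*S_x$ and $P_x=S_xS_x^*$: the $Q_x$ commute with one another; $S_i^*S_j=0$ for $i\ne j$; $Q_iS_j=A(i,j)S_j$ for all $i,j$; and $$\prod_{x\in X}Q_x\prod_{y\in Y}(1-Q_y)=\sum_{j\in\mathcal G}A(X,Y,j)P_j,\qquad A(X,Y,j):=\prod_{x\in X}A(x,j)\prod_{y\in Y}(1-A(y,j)),$$ for all finite $X,Y\subseteq\mathcal G$ such that $A(X,Y,j)=0$ for all but finitely many $j$. **Theorem.** The C*-algebras $\tilde{\mathcal O}(\Lambda_A)$ and $\tilde{\mathcal O}_A$ are *-isomorphic. -/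

import Mathlib

open scoped ENNReal

universe u v

noncomputable section

/-! ### Partial isometries and universal unital C*-algebras -/

section PartialIsometry

variable {B : Type v} [CStarAlgebra B]

/-- `s` is a partial isometry: `s s* s = s`. -/
def IsPartialIsometry (s : B) : Prop := s * star s * s = s

/-- The initial projection `s* s`. -/
def iniProj (s : B) : B := star s * s

/-- The final projection `s s*`. -/
def finProj (s : B) : B := s * star s

theorem IsPartialIsometry.norm_le_one {s : B} (hs : IsPartialIsometry s) : ‖s‖ ≤ 1 := by
  have h1 : (star s * s) * (star s * s) = star s * s := by
    rw [mul_assoc, ← mul_assoc s, hs]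
  have h2 : ‖star s * s‖ * ‖star s * s‖ = ‖star s * s‖ := by
    conv_rhs => rw [← h1]
    rw [← CStarRing.norm_star_mul_self]
    simp
  have h3 := CStarRing.norm_star_mul_self (x := s)
  rw [h3] at h2
  by_contra h
  push Not at h
  nlinarith [mul_pos (by linarith : 0 < ‖s‖) (by linarith : 0 < ‖s‖),
    mul_lt_mul'' h h (by norm_num) (by norm_num)]

end PartialIsometry

/-- A system of relations on a family of partial isometries indexed by `X`: a condition on
`X`-indexed families in unital C*-algebras that forces every member to be a partial isometry. -/
structure PartialIsometryRelations (X : Type u) where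
  Holds : ∀ (B : Type u) [CStarAlgebra B], (X → B) → Prop
  isPartialIsometry : ∀ (B : Type u) [CStarAlgebra B] (S : X → B),
    Holds B S → ∀ x, IsPartialIsometry (S x)

namespace PartialIsometryRelations

variable {X : Type u} (R : PartialIsometryRelations X)

/-- A family satisfying the relations in a nonzero unital C*-algebra. (The zero algebra contributes
nothing to the universal norm. Every C*-algebra generated by an `X`-indexed family has an isomorphic
copy in `Type u`, so that nothing is lost by the restriction to this universe either.) -/
structure Model where
  carrier : Type u
  [cstarAlgebra : CStarAlgebra carrier]
  [nontrivial : Nontrivial carrier]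
  family : X → carrier
  holds : R.Holds carrier family

attribute [instance] Model.cstarAlgebra Model.nontrivial

/-- The C*-algebra of bounded functions choosing an element of each model. -/
def Product : Type (u + 1) := lp (fun M : R.Model => M.carrier) ∞

instance lpCStarAlgebra (ι : Type v) (B : ι → Type u) [∀ i, CStarAlgebra (B i)] [∀ i, Nontrivial (B i)] :
    CStarAlgebra (lp B ∞) where

instance : CStarAlgebra R.Product :=
  inferInstanceAs (CStarAlgebra (lp (fun M : R.Model => M.carrier) ∞))

/-- The family in the product whose coordinate at each model is the family of that model. -/
def productFamily (x : X) : R.Product :=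
  ⟨fun M => M.family x, memℓp_infty ⟨1, by
    rintro _ ⟨M, rfl⟩
    exact (R.isPartialIsometry M.carrier M.family M.holds x).norm_le_one⟩⟩

/-- The universal unital C*-algebra generated by partial isometries indexed by `X` subject to the
relations `R`: the closed unital *-subalgebra generated by the diagonal family inside the product
over all models. Equivalently, it is the completion of the free unital *-algebra on `X` in the
largest C*-seminorm that comes from a family satisfying the relations. -/
def universalSubalgebra : StarSubalgebra ℂ R.Product :=
  (StarAlgebra.adjoin ℂ (Set.range R.productFamily)).topologicalClosure

/-- The universal unital C*-algebra as a type. -/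
def Universal : Type (u + 1) := R.universalSubalgebra

instance : IsClosed (R.universalSubalgebra : Set R.Product) :=
  StarSubalgebra.isClosed_topologicalClosure _

instance : CStarAlgebra R.Universal := StarSubalgebra.cstarAlgebra R.universalSubalgebra

/-- The standard generators. -/
def generator (x : X) : R.Universal :=
  ⟨R.productFamily x, StarSubalgebra.le_topologicalClosure _
    (StarAlgebra.subset_adjoin ℂ _ ⟨x, rfl⟩)⟩

end PartialIsometryRelations

/-! ### Semigroupoids -/

/-- A semigroupoid: a set `Λ` with a partially defined operation, whose domain is the set of
composable pairs, which is associative in the strong sense. -/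
class Semigroupoid (Λ : Type u) where
  Composable : Λ → Λ → Prop
  comp : ∀ f g : Λ, Composable f g → Λ
  assoc_basic : ∀ (f g h : Λ) (hfg : Composable f g) (hgh : Composable g h),
    ∃ (h₁ : Composable (comp f g hfg) h) (h₂ : Composable f (comp g h hgh)),
      comp (comp f g hfg) h h₁ = comp f (comp g h hgh) h₂
  assoc_left : ∀ (f g h : Λ) (hfg : Composable f g) (h₁ : Composable (comp f g hfg) h),
    ∃ (hgh : Composable g h) (h₂ : Composable f (comp g h hgh)),
      comp (comp f g hfg) h h₁ = comp f (comp g h hgh) h₂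
  assoc_right : ∀ (f g h : Λ) (hgh : Composable g h) (h₂ : Composable f (comp g h hgh)),
    ∃ (hfg : Composable f g) (h₁ : Composable (comp f g hfg) h),
      comp (comp f g hfg) h h₁ = comp f (comp g h hgh) h₂

namespace Semigroupoid

variable {Λ : Type u} [Semigroupoid Λ]

/-- `f` divides `g`. -/
def Divides (f g : Λ) : Prop := f = g ∨ ∃ (h : Λ) (hfh : Composable f h), comp f h hfh = g

/-- `f` and `g` have a common multiple. -/
def Intersects (f g : Λ) : Prop := ∃ m : Λ, Divides f m ∧ Divides g m

/-- The set `Λ^f` of elements that can be multiplied on the left by `f`, for `f` in the unitization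
`Λ ∪ {1}`, modelled by `Option Λ` with `none` as the extra unit; `Λ^1 = Λ`. -/
def rightDomain : Option Λ → Set Λ
  | none => Set.univ
  | some f => {g | Composable f g}

/-- The set `Λ^{F,G}`: the intersection of the `Λ^f` for `f ∈ F` and of the complements of the `Λ^g`
for `g ∈ G`. -/
def domainSet (F G : Finset (Option Λ)) : Set Λ :=
  {h | (∀ f ∈ F, h ∈ rightDomain f) ∧ ∀ g ∈ G, h ∉ rightDomain g}

/-- `H` is a covering of `X`. -/
def IsCovering (H X : Set Λ) : Prop := H ⊆ X ∧ ∀ f ∈ X, ∃ h ∈ H, Intersects h f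

variable {B : Type v} [CStarAlgebra B]

/-- A representation of a semigroupoid in a unital C*-algebra. -/
structure IsRepresentation (S : Λ → B) : Prop where
  isPartialIsometry : ∀ f, IsPartialIsometry (S f)
  mul_of_composable : ∀ (f g : Λ) (h : Composable f g), S f * S g = S (comp f g h)
  mul_of_not_composable : ∀ f g : Λ, ¬ Composable f g → S f * S g = 0
  commute_ini_ini : ∀ f g : Λ, Commute (iniProj (S f)) (iniProj (S g))
  commute_fin_fin : ∀ f g : Λ, Commute (finProj (S f)) (finProj (S g))
  commute_ini_fin : ∀ f g : Λ, Commute (iniProj (S f)) (finProj (S g))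
  fin_mul_fin_of_disjoint : ∀ f g : Λ, ¬ Intersects f g → finProj (S f) * finProj (S g) = 0
  ini_mul_fin : ∀ f g : Λ, Composable f g → iniProj (S f) * finProj (S g) = finProj (S g)

/-- The initial projections `Q_f` for `f` in the unitization, with `Q_1 = 1`. -/
def iniExt (S : Λ → B) : Option Λ → B
  | none => 1
  | some f => iniProj (S f)

theorem IsRepresentation.commute_iniExt {S : Λ → B} (hS : IsRepresentation S) (f g : Option Λ) :
    Commute (iniExt S f) (iniExt S g) := by
  cases f <;> cases g <;> simp [iniExt, hS.commute_ini_ini]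

theorem IsRepresentation.commute_one_sub_iniExt {S : Λ → B} (hS : IsRepresentation S)
    (f g : Option Λ) : Commute (1 - iniExt S f) (1 - iniExt S g) :=
  (Commute.one_left _).sub_left ((Commute.one_right _).sub_right (hS.commute_iniExt f g))

theorem IsRepresentation.commute_one_sub_fin {S : Λ → B} (hS : IsRepresentation S)
    (f g : Λ) : Commute (1 - finProj (S f)) (1 - finProj (S g)) :=
  (Commute.one_left _).sub_left ((Commute.one_right _).sub_right (hS.commute_fin_fin f g))

/-- A tight representation. The supremum of the finitely many commuting projections `P_h`, `h ∈ H`,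
where `P ∨ P' = P + P' - P P'`, is written as `1 - ∏ (1 - P_h)`. -/
structure IsTight (S : Λ → B) : Prop extends IsRepresentation S where
  tight : ∀ (F G : Finset (Option Λ)) (H : Finset Λ),
    IsCovering (H : Set Λ) (domainSet F G) →
    1 - H.noncommProd (fun h => 1 - finProj (S h))
        (fun f _ g _ _ => toIsRepresentation.commute_one_sub_fin f g) =
      F.noncommProd (fun f => iniExt S f) (fun f _ g _ _ => toIsRepresentation.commute_iniExt f g) *
      G.noncommProd (fun g => 1 - iniExt S g)
        (fun f _ g _ _ => toIsRepresentation.commute_one_sub_iniExt f g)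

variable (Λ)

/-- The relations saying that `f ↦ S_f` is a tight representation. -/
def tightRelations : PartialIsometryRelations Λ where
  Holds _ _ S := IsTight S
  isPartialIsometry _ _ _ h := h.isPartialIsometry

/-- The unital semigroupoid C*-algebra. -/
abbrev UnitalCStarAlgebra : Type (u + 1) := (tightRelations Λ).Universal

end Semigroupoid

/-! ### The Markov semigroupoid of a 0-1 matrix -/

section Markov

variable {𝒢 : Type u} (A : Matrix 𝒢 𝒢 ℤ)

/-- Nonempty finite words all of whose consecutive letters `i j` satisfy `A i j = 1`. -/
structure MarkovWord where
  letters : List 𝒢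
  ne_nil : letters ≠ []
  admissible : letters.IsChain (fun i j => A i j = 1)

variable {A}

/-- The product of `α` and `β` is allowed if `A` is `1` at the last letter of `α` and the first
letter of `β`. -/
def MarkovWord.Composable (α β : MarkovWord A) : Prop :=
  A (α.letters.getLast α.ne_nil) (β.letters.head β.ne_nil) = 1

/-- Concatenation of words. -/
def MarkovWord.comp (α β : MarkovWord A) (h : α.Composable β) : MarkovWord A where
  letters := α.letters ++ β.letters
  ne_nil := by simp [α.ne_nil]
  admissible := by
    refine α.admissible.append β.admissible ?_
    intro x hx y hy
    rw [List.getLast?_eq_some_getLast α.ne_nil] at hx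
    rw [List.head?_eq_some_head β.ne_nil] at hy
    simp only [Option.mem_def, Option.some.injEq] at hx hy
    subst hx hy
    exact h

theorem MarkovWord.comp_composable_iff {α β γ : MarkovWord A} (h : α.Composable β) :
    (α.comp β h).Composable γ ↔ β.Composable γ := by
  simp [Composable, comp, β.ne_nil]

theorem MarkovWord.composable_comp_iff {α β γ : MarkovWord A} (h : β.Composable γ) :
    α.Composable (β.comp γ h) ↔ α.Composable β := by
  simp [Composable, comp, List.head_append_of_ne_nil, β.ne_nil]

variable (A)

/-- The Markov semigroupoid `Λ_A`. -/
instance markovSemigroupoid : Semigroupoid (MarkovWord A) where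
  Composable := MarkovWord.Composable
  comp := MarkovWord.comp
  assoc_basic f g h hfg hgh :=
    ⟨(MarkovWord.comp_composable_iff hfg).2 hgh, (MarkovWord.composable_comp_iff hgh).2 hfg, by
      simp [MarkovWord.comp]⟩
  assoc_left f g h hfg h₁ :=
    ⟨(MarkovWord.comp_composable_iff hfg).1 h₁, (MarkovWord.composable_comp_iff _).2 hfg, by
      simp [MarkovWord.comp]⟩
  assoc_right f g h hgh h₂ :=
    ⟨(MarkovWord.composable_comp_iff hgh).1 h₂, (MarkovWord.comp_composable_iff _).2 hgh, by
      simp [MarkovWord.comp]⟩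

/-! ### The unital Cuntz-Krieger algebra of a 0-1 matrix -/

/-- `A(X,Y,j) = ∏_{x ∈ X} A(x,j) ∏_{y ∈ Y} (1 - A(y,j))`. -/
def matrixEntryProd (X Y : Finset 𝒢) (j : 𝒢) : ℤ :=
  (∏ x ∈ X, A x j) * ∏ y ∈ Y, (1 - A y j)

variable {B : Type v} [CStarAlgebra B]

/-- A Toeplitz-Cuntz-Krieger family for `A`. -/
structure IsToeplitzCuntzKriegerFamily (S : 𝒢 → B) : Prop where
  isPartialIsometry : ∀ i, IsPartialIsometry (S i)
  commute_ini : ∀ i j, Commute (iniProj (S i)) (iniProj (S j))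
  star_mul : ∀ i j, i ≠ j → star (S i) * S j = 0
  ini_mul : ∀ i j, iniProj (S i) * S j = A i j • S j

variable {A}

theorem IsToeplitzCuntzKriegerFamily.commute_one_sub_ini {S : 𝒢 → B}
    (hS : IsToeplitzCuntzKriegerFamily A S) (i j : 𝒢) :
    Commute (1 - iniProj (S i)) (1 - iniProj (S j)) :=
  (Commute.one_left _).sub_left ((Commute.one_right _).sub_right (hS.commute_ini i j))

variable (A)

/-- An Exel-Laca Cuntz-Krieger family for `A`: a Toeplitz-Cuntz-Krieger family that satisfies in
addition `∏_{x ∈ X} Q_x ∏_{y ∈ Y} (1 - Q_y) = ∑_j A(X,Y,j) P_j` for all finite sets `X`, `Y` for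
which only finitely many of the `A(X,Y,j)` are nonzero. -/
structure IsCuntzKriegerFamily (S : 𝒢 → B) : Prop extends IsToeplitzCuntzKriegerFamily A S where
  prod_ini : ∀ (X Y : Finset 𝒢) (hfin : {j | matrixEntryProd A X Y j ≠ 0}.Finite),
    X.noncommProd (fun x => iniProj (S x))
        (fun i _ j _ _ => toIsToeplitzCuntzKriegerFamily.commute_ini i j) *
      Y.noncommProd (fun y => 1 - iniProj (S y))
        (fun i _ j _ _ => toIsToeplitzCuntzKriegerFamily.commute_one_sub_ini i j) =
      ∑ j ∈ hfin.toFinset, matrixEntryProd A X Y j • finProj (S j)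

/-- The defining relations of the unital Cuntz-Krieger algebra. -/
def cuntzKriegerRelations : PartialIsometryRelations 𝒢 where
  Holds _ _ S := IsCuntzKriegerFamily A S
  isPartialIsometry _ _ _ h := h.isPartialIsometry

/-- The unital Cuntz-Krieger algebra of `A`. -/
abbrev UnitalCuntzKriegerAlgebra : Type (u + 1) := (cuntzKriegerRelations A).Universal

end Markov

end

/-! ### Products of commuting families -/

namespace Finset

/-! The two sets of relations have the same solutions in every C*-algebra. A Cuntz-Krieger family
gives a tight representation by multiplying along words, S_α = S_{α₁} ⋯ S_{αₙ}; a tight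
representation gives a Cuntz-Krieger family by restriction to one-letter words. By `wordProd_single`
the passages are mutually inverse, so the induced homomorphisms of the universal algebras are
inverse on generators.

The substance is that tightness matches the Exel-Laca relations. Since Q_α depends only on the last
letter of α, for 1 ∉ G the set Λ^{F,G} consists of the words whose first letter j has A(X,Y,j) ≠ 0,
where X and Y are the last letters occurring in F and G.

If finitely many such j exist, the one-letter words j form a finite covering with pairwise
orthogonal P_j, so tightness yields the Exel-Laca relation
(`Semigroupoid.IsTight.isCuntzKriegerFamily`).

Conversely, a finite covering H of Λ^{F,G} leaves only finitely many such j, so the product of the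
Q's and their complements is ∑ P_j. It remains to bound each P_j by the supremum of the P_h. While
no h ∈ H is a prefix of α, only finitely many letters can follow α, and the relation for X = {last
letter}, Y = ∅ splits P_α into the P_{αj}; this stops once the words are as long as those of H
(`noncommProd_one_sub_mul_finProj`). -/

theorem noncommProd_mul_eq_self {ι M : Type*} [Monoid M] (s : Finset ι) (f : ι → M) (comm) {x : M}
    (h : ∀ i ∈ s, f i * x = x) : s.noncommProd f comm * x = x :=
  s.noncommProd_induction f comm (fun a => a * x = x)
    (fun a b ha hb => by rw [mul_assoc, hb, ha]) (one_mul x) h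

theorem mul_noncommProd_of_idempotent {ι M : Type*} [Monoid M] (s : Finset ι) (f : ι → M) (comm)
    {i : ι} (hi : i ∈ s) (hf : f i * f i = f i) :
    f i * s.noncommProd f comm = s.noncommProd f comm := by
  classical
  rw [← mul_noncommProd_erase s hi f comm, ← mul_assoc, hf]

/-- Two products of commuting idempotents agree if, up to factors `1`, they have the same
factors. -/
theorem noncommProd_eq_of_factors {ι κ M : Type*} [Monoid M] (s : Finset ι) (t : Finset κ)
    (f : ι → M) (g : κ → M) (commf) (commg) (hfg : ∀ i j, Commute (f i) (g j))
    (hf : ∀ i, f i * f i = f i) (hg : ∀ j, g j * g j = g j)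
    (hst : ∀ i ∈ s, f i = 1 ∨ ∃ j ∈ t, f i = g j) (hts : ∀ j ∈ t, ∃ i ∈ s, f i = g j) :
    s.noncommProd f commf = t.noncommProd g commg := by
  -- Each product is absorbed by every factor of the other; as the two products commute, they
  -- coincide.
  have h₁ : s.noncommProd f commf * t.noncommProd g commg = t.noncommProd g commg := by
    refine noncommProd_mul_eq_self s f commf fun i hi => ?_
    rcases hst i hi with h | ⟨j, hj, h⟩
    · rw [h, one_mul]
    · rw [h, mul_noncommProd_of_idempotent t g commg hj (hg j)]
  have h₂ : t.noncommProd g commg * s.noncommProd f commf = s.noncommProd f commf := by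
    refine noncommProd_mul_eq_self t g commg fun j hj => ?_
    obtain ⟨i, hi, h⟩ := hts j hj
    rw [← h, mul_noncommProd_of_idempotent s f commf hi (hf i)]
  have h₃ : Commute (s.noncommProd f commf) (t.noncommProd g commg) :=
    noncommProd_commute _ _ _ _ fun j _ =>
      (noncommProd_commute _ _ _ _ fun i _ => (hfg i j).symm).symm
  rw [← h₂, ← h₃.eq, h₁]

/-- Criterion for e to be the supremum of the p i: each p i lies below e, and the complement of the
supremum annihilates e. The first condition makes every 1 - p i, hence their product, fix 1 - e. -/
theorem one_sub_noncommProd_one_sub_eq {ι R : Type*} [Ring R] (s : Finset ι) (p : ι → R) (comm)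
    {e : R} (h : ∀ i ∈ s, p i * e = p i) (he : s.noncommProd (fun i => 1 - p i) comm * e = 0) :
    1 - s.noncommProd (fun i => 1 - p i) comm = e := by
  have h₁ := noncommProd_mul_eq_self s (fun i => 1 - p i) comm (x := 1 - e) fun i hi => by
    rw [sub_mul, one_mul, mul_sub, h i hi, mul_one, sub_self, sub_zero]
  rw [mul_sub, mul_one, he, sub_zero] at h₁
  rw [h₁, sub_sub_cancel]

theorem noncommProd_one_sub_mul_eq_zero {ι R : Type*} [Ring R] (s : Finset ι) (p : ι → R) (comm)
    {i : ι} (hi : i ∈ s) {x : R} (hx : p i * x = x) :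
    s.noncommProd (fun i => 1 - p i) comm * x = 0 := by
  classical
  rw [← noncommProd_erase_mul s hi (fun i => 1 - p i) comm, mul_assoc, sub_mul, hx, one_mul,
    sub_self, mul_zero]

end Finset

/-! ### Partial isometries -/

section PartialIsometry

variable {B : Type v} [CStarAlgebra B] {s : B}

theorem star_iniProj (s : B) : star (iniProj s) = iniProj s := by simp [iniProj]

theorem star_finProj (s : B) : star (finProj s) = finProj s := by simp [finProj]

theorem IsPartialIsometry.finProj_mul (hs : IsPartialIsometry s) : finProj s * s = s := hs

theorem IsPartialIsometry.mul_iniProj (hs : IsPartialIsometry s) : s * iniProj s = s := by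
  rw [iniProj, ← mul_assoc]; exact hs

theorem IsPartialIsometry.star_mul_finProj (hs : IsPartialIsometry s) :
    star s * finProj s = star s := by
  have h := congrArg star hs.finProj_mul
  rwa [star_mul, star_finProj] at h

theorem IsPartialIsometry.iniProj_mul_self (hs : IsPartialIsometry s) :
    iniProj s * iniProj s = iniProj s := by
  conv_lhs => rw [iniProj, mul_assoc, ← iniProj, hs.mul_iniProj]
  rfl

theorem IsPartialIsometry.finProj_mul_self (hs : IsPartialIsometry s) :
    finProj s * finProj s = finProj s := by
  conv_lhs => rw [finProj, mul_assoc, ← finProj, hs.star_mul_finProj]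
  rfl

theorem one_sub_mul_one_sub_self {R : Type*} [Ring R] {p : R} (hp : p * p = p) :
    (1 - p) * (1 - p) = 1 - p := by
  rw [mul_sub, mul_one, sub_mul, hp, one_mul, sub_self, sub_zero]

end PartialIsometry

/-! ### Divisibility in the Markov semigroupoid -/

namespace MarkovWord

variable {𝒢 : Type u} {A : Matrix 𝒢 𝒢 ℤ}

attribute [ext] MarkovWord

/-- The first letter. -/
def first (α : MarkovWord A) : 𝒢 := α.letters.head α.ne_nil

/-- The last letter. -/
def last (α : MarkovWord A) : 𝒢 := α.letters.getLast α.ne_nil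

/-- The word with a single letter. -/
def single (i : 𝒢) : MarkovWord A := ⟨[i], by simp, by simp⟩

theorem composable_iff (α β : MarkovWord A) :
    Semigroupoid.Composable α β ↔ A α.last β.first = 1 := Iff.rfl

@[simp] theorem last_single (i : 𝒢) : (single i : MarkovWord A).last = i := rfl

@[simp] theorem first_single (i : 𝒢) : (single i : MarkovWord A).first = i := rfl

@[simp] theorem letters_single (i : 𝒢) : (single i : MarkovWord A).letters = [i] := rfl

theorem letters_comp (α β : MarkovWord A) (h : Semigroupoid.Composable α β) :
    (Semigroupoid.comp α β h).letters = α.letters ++ β.letters := rfl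

theorem letters_eq_cons (α : MarkovWord A) : ∃ l, α.letters = α.first :: l :=
  ⟨α.letters.tail, (List.cons_head_tail α.ne_nil).symm⟩

/-- The remainder after the prefix is either empty, which is the case of equality, or itself an
admissible word composable with α. -/
theorem divides_iff (α β : MarkovWord A) :
    Semigroupoid.Divides α β ↔ α.letters <+: β.letters := by
  constructor
  · rintro (rfl | ⟨γ, h, rfl⟩)
    · exact List.prefix_rfl
    · exact ⟨γ.letters, rfl⟩
  · rintro ⟨l, hl⟩
    by_cases h : l = []
    · left
      ext1
      rw [← hl, h, List.append_nil]
    · have hβ := β.admissible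
      rw [← hl, List.isChain_append] at hβ
      refine Or.inr ⟨⟨l, h, hβ.2.1⟩, ?_, MarkovWord.ext hl⟩
      exact hβ.2.2 _ (List.getLast?_eq_some_getLast α.ne_nil) _ (List.head?_eq_some_head h)

theorem intersects_iff (α β : MarkovWord A) :
    Semigroupoid.Intersects α β ↔ α.letters <+: β.letters ∨ β.letters <+: α.letters := by
  simp only [Semigroupoid.Intersects, divides_iff]
  constructor
  · rintro ⟨γ, h₁, h₂⟩
    exact List.prefix_or_prefix_of_prefix h₁ h₂
  · rintro (h | h)
    · exact ⟨β, h, List.prefix_rfl⟩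
    · exact ⟨α, List.prefix_rfl, h⟩

theorem first_eq_of_prefix {α β : MarkovWord A} (h : α.letters <+: β.letters) :
    α.first = β.first := by
  obtain ⟨l, hl⟩ := α.letters_eq_cons
  obtain ⟨m, hm⟩ := β.letters_eq_cons
  rw [hl, hm, List.cons_prefix_cons] at h
  exact h.1

theorem single_prefix_iff (i : 𝒢) (β : MarkovWord A) :
    (single i : MarkovWord A).letters <+: β.letters ↔ i = β.first := by
  obtain ⟨m, hm⟩ := β.letters_eq_cons
  rw [hm]
  simp [List.cons_prefix_cons]

theorem first_eq_of_intersects {α β : MarkovWord A} (h : Semigroupoid.Intersects α β) :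
    α.first = β.first := by
  rw [intersects_iff] at h
  exact h.elim first_eq_of_prefix fun h => (first_eq_of_prefix h).symm

end MarkovWord

/-! ### Products over words in a Toeplitz-Cuntz-Krieger family -/

namespace IsToeplitzCuntzKriegerFamily

variable {𝒢 : Type u} {A : Matrix 𝒢 𝒢 ℤ} {B : Type v} [CStarAlgebra B] {S : 𝒢 → B}

theorem iniProj_mul_prod (hS : IsToeplitzCuntzKriegerFamily A S) (i : 𝒢) (l : List 𝒢) (h : l ≠ []) :
    iniProj (S i) * (l.map S).prod = A i (l.head h) • (l.map S).prod := by
  cases l with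
  | nil => exact absurd rfl h
  | cons j l => simp [← mul_assoc, hS.ini_mul]

/-- Telescoping: the inner S_i* S_i = Q_i acts as the identity on the next letter by admissibility,
so only the last letter survives. -/
theorem star_prod_mul_prod (hS : IsToeplitzCuntzKriegerFamily A S) :
    ∀ (l : List 𝒢) (h : l ≠ []), l.IsChain (fun i j => A i j = 1) →
      star (l.map S).prod * (l.map S).prod = iniProj (S (l.getLast h))
  | [], h, _ => absurd rfl h
  | [i], _, _ => by simp [iniProj]
  | i :: j :: l, _, hl => by
    rw [List.isChain_cons_cons] at hl
    have ih := star_prod_mul_prod hS (j :: l) (by simp) hl.2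
    have h := hS.iniProj_mul_prod i (j :: l) (by simp)
    rw [List.head_cons, hl.1, one_smul] at h
    rw [List.map_cons, List.prod_cons, StarMul.star_mul, mul_assoc, ← mul_assoc (star (S i)), ← iniProj, h,
      ih, List.getLast_cons_cons]

/-- Common first letters cancel up to a scalar A(i,j); incomparable words must eventually disagree,
and there S_i* S_j = 0. -/
theorem star_prod_mul_prod_of_not_prefix (hS : IsToeplitzCuntzKriegerFamily A S) :
    ∀ l m : List 𝒢, ¬ l <+: m → ¬ m <+: l → star (l.map S).prod * (m.map S).prod = 0
  | [], _, h, _ => absurd List.nil_prefix h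
  | _, [], _, h => absurd List.nil_prefix h
  | i :: l, j :: m, h₁, h₂ => by
    rw [List.map_cons, List.prod_cons, StarMul.star_mul, List.map_cons, List.prod_cons, mul_assoc,
      ← mul_assoc (star (S i))]
    by_cases hij : i = j
    · subst hij
      rw [List.cons_prefix_cons] at h₁ h₂
      simp only [true_and] at h₁ h₂
      have hm : m ≠ [] := by
        rintro rfl
        exact h₂ List.nil_prefix
      rw [← iniProj, hS.iniProj_mul_prod i m hm, mul_smul_comm,
        star_prod_mul_prod_of_not_prefix hS l m h₁ h₂, smul_zero]
    · rw [hS.star_mul i j hij, zero_mul, mul_zero]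

/-- The element `S_α = S_{α₁} ⋯ S_{αₙ}`. -/
def wordProd (S : 𝒢 → B) (α : MarkovWord A) : B := (α.letters.map S).prod

theorem iniProj_wordProd (hS : IsToeplitzCuntzKriegerFamily A S) (α : MarkovWord A) :
    iniProj (wordProd S α) = iniProj (S α.last) :=
  hS.star_prod_mul_prod α.letters α.ne_nil α.admissible

theorem iniProj_mul_wordProd (hS : IsToeplitzCuntzKriegerFamily A S) (i : 𝒢) (α : MarkovWord A) :
    iniProj (S i) * wordProd S α = A i α.first • wordProd S α :=
  hS.iniProj_mul_prod i α.letters α.ne_nil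

theorem wordProd_mul_iniProj (hS : IsToeplitzCuntzKriegerFamily A S) (α : MarkovWord A) :
    wordProd S α * iniProj (S α.last) = wordProd S α := by
  have h : wordProd S α = ((α.letters.dropLast.map S).prod) * S α.last := by
    rw [wordProd, ← List.dropLast_append_getLast α.ne_nil, List.map_append, List.prod_append]
    simp [MarkovWord.last]
  rw [h, mul_assoc, (hS.isPartialIsometry _).mul_iniProj]

theorem isPartialIsometry_wordProd (hS : IsToeplitzCuntzKriegerFamily A S) (α : MarkovWord A) :
    IsPartialIsometry (wordProd S α) := by
  rw [IsPartialIsometry, mul_assoc]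
  change _ * iniProj _ = _
  rw [hS.iniProj_wordProd, hS.wordProd_mul_iniProj]

theorem iniProj_mul_finProj_wordProd (hS : IsToeplitzCuntzKriegerFamily A S) (i : 𝒢)
    (α : MarkovWord A) :
    iniProj (S i) * finProj (wordProd S α) = A i α.first • finProj (wordProd S α) := by
  rw [finProj, ← mul_assoc, hS.iniProj_mul_wordProd, smul_mul_assoc]

theorem commute_iniProj_finProj_wordProd (hS : IsToeplitzCuntzKriegerFamily A S) (i : 𝒢)
    (α : MarkovWord A) : Commute (iniProj (S i)) (finProj (wordProd S α)) := by
  have h := hS.iniProj_mul_finProj_wordProd i α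
  -- The product is an integer multiple of a projection, hence self-adjoint, and two self-adjoint
  -- elements with self-adjoint product commute.
  have h' := congrArg star h
  rw [StarMul.star_mul, star_iniProj, star_finProj, star_zsmul, star_finProj, ← h] at h'
  exact h'.symm

theorem finProj_mul_finProj_of_prefix (hS : IsToeplitzCuntzKriegerFamily A S)
    {α β : MarkovWord A} (h : α.letters <+: β.letters) :
    finProj (wordProd S α) * finProj (wordProd S β) = finProj (wordProd S β) := by
  obtain ⟨l, hl⟩ := h
  have hβ : wordProd S β = wordProd S α * (l.map S).prod := by
    rw [wordProd, wordProd, ← hl, List.map_append, List.prod_append]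
  have : finProj (wordProd S α) * wordProd S β = wordProd S β := by
    rw [hβ, ← mul_assoc, (hS.isPartialIsometry_wordProd α).finProj_mul]
  conv_lhs => rw [finProj.eq_1 (wordProd S β), ← mul_assoc, this]
  rfl

theorem finProj_mul_finProj_of_not_intersects (hS : IsToeplitzCuntzKriegerFamily A S)
    {α β : MarkovWord A} (h : ¬ Semigroupoid.Intersects α β) :
    finProj (wordProd S α) * finProj (wordProd S β) = 0 := by
  rw [MarkovWord.intersects_iff, not_or] at h
  rw [finProj, finProj, mul_assoc, ← mul_assoc (star _)]
  have := hS.star_prod_mul_prod_of_not_prefix _ _ h.1 h.2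
  rw [wordProd, wordProd, this, zero_mul, mul_zero]

theorem commute_finProj_finProj (hS : IsToeplitzCuntzKriegerFamily A S) (α β : MarkovWord A) :
    Commute (finProj (wordProd S α)) (finProj (wordProd S β)) := by
  have key : ∀ p q : B, star p = p → star q = q → p * q = q → Commute p q := fun p q hp hq h => by
    have h' := congrArg star h
    rw [StarMul.star_mul, hp, hq] at h'
    exact h.trans h'.symm
  by_cases h : Semigroupoid.Intersects α β
  · rcases (MarkovWord.intersects_iff α β).1 h with h | h
    · exact key _ _ (star_finProj _) (star_finProj _) (hS.finProj_mul_finProj_of_prefix h)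
    · exact (key _ _ (star_finProj _) (star_finProj _) (hS.finProj_mul_finProj_of_prefix h)).symm
  · have h' : ¬ Semigroupoid.Intersects β α := fun ⟨m, h₁, h₂⟩ => h ⟨m, h₂, h₁⟩
    exact (hS.finProj_mul_finProj_of_not_intersects h).trans
      (hS.finProj_mul_finProj_of_not_intersects h').symm

theorem isRepresentation_wordProd (hS : IsToeplitzCuntzKriegerFamily A S)
    (hA : ∀ i j, A i j = 0 ∨ A i j = 1) :
    Semigroupoid.IsRepresentation (wordProd S : MarkovWord A → B) where
  isPartialIsometry := hS.isPartialIsometry_wordProd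
  mul_of_composable f g h := by
    rw [wordProd, wordProd, wordProd, MarkovWord.letters_comp, List.map_append, List.prod_append]
  mul_of_not_composable f g h := by
    have h₀ : A f.last g.first = 0 := (hA _ _).resolve_right h
    rw [← hS.wordProd_mul_iniProj f, mul_assoc, hS.iniProj_mul_wordProd, h₀, zero_smul, mul_zero]
  commute_ini_ini f g := by
    rw [hS.iniProj_wordProd, hS.iniProj_wordProd]
    exact hS.commute_ini _ _
  commute_fin_fin := hS.commute_finProj_finProj
  commute_ini_fin f g := by
    rw [hS.iniProj_wordProd]
    exact hS.commute_iniProj_finProj_wordProd _ _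
  fin_mul_fin_of_disjoint f g h := hS.finProj_mul_finProj_of_not_intersects h
  ini_mul_fin f g h := by
    rw [hS.iniProj_wordProd, hS.iniProj_mul_finProj_wordProd, (MarkovWord.composable_iff f g).1 h,
      one_smul]

end IsToeplitzCuntzKriegerFamily

/-! ### Cuntz-Krieger families give tight representations -/

section MatrixEntryProd

variable {𝒢 : Type u} {A : Matrix 𝒢 𝒢 ℤ}

theorem matrixEntryProd_ne_zero_iff (hA : ∀ i j, A i j = 0 ∨ A i j = 1) (X Y : Finset 𝒢) (j : 𝒢) :
    matrixEntryProd A X Y j ≠ 0 ↔ (∀ x ∈ X, A x j = 1) ∧ ∀ y ∈ Y, A y j ≠ 1 := by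
  rw [matrixEntryProd, mul_ne_zero_iff, Finset.prod_ne_zero_iff, Finset.prod_ne_zero_iff]
  refine and_congr (forall₂_congr fun x _ => ?_) (forall₂_congr fun y _ => ?_)
  · rcases hA x j with h | h <;> simp [h]
  · rcases hA y j with h | h <;> simp [h]

theorem matrixEntryProd_eq_one (hA : ∀ i j, A i j = 0 ∨ A i j = 1) {X Y : Finset 𝒢} {j : 𝒢}
    (h : matrixEntryProd A X Y j ≠ 0) : matrixEntryProd A X Y j = 1 := by
  rw [matrixEntryProd_ne_zero_iff hA] at h
  rw [matrixEntryProd, Finset.prod_eq_one h.1, Finset.prod_eq_one, mul_one]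
  intro y hy
  rw [(hA y j).resolve_right (h.2 y hy), sub_zero]

end MatrixEntryProd

/-! ### Domain sets described by last letters -/

namespace MarkovWord

variable {𝒢 : Type u} {A : Matrix 𝒢 𝒢 ℤ}

/-- The word `α` followed by the letter `j`. -/
def snoc (α : MarkovWord A) (j : 𝒢) (h : A α.last j = 1) : MarkovWord A :=
  Semigroupoid.comp α (single j) h

theorem letters_snoc (α : MarkovWord A) (j : 𝒢) (h : A α.last j = 1) :
    (α.snoc j h).letters = α.letters ++ [j] := rfl

open Classical in
/-- The set of last letters of the words in a subset of the unitization. -/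
noncomputable def lastLetters (F : Finset (Option (MarkovWord A))) : Finset 𝒢 :=
  F.eraseNone.image last

theorem mem_lastLetters {F : Finset (Option (MarkovWord A))} {i : 𝒢} :
    i ∈ lastLetters F ↔ ∃ α : MarkovWord A, some α ∈ F ∧ α.last = i := by
  simp [lastLetters]

/-- Composability sees only the last letter on the left and the first on the right. The unit imposes
nothing in F, but in G it would make the set empty. -/
theorem mem_domainSet_iff (F G : Finset (Option (MarkovWord A))) (hG : none ∉ G)
    (β : MarkovWord A) :
    β ∈ Semigroupoid.domainSet F G ↔
      (∀ x ∈ lastLetters F, A x β.first = 1) ∧ ∀ y ∈ lastLetters G, A y β.first ≠ 1 := by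
  refine and_congr ⟨fun h x hx => ?_, fun h f hf => ?_⟩ ⟨fun h y hy => ?_, fun h g hg => ?_⟩
  · obtain ⟨α, hα, rfl⟩ := mem_lastLetters.1 hx
    exact h _ hα
  · cases f with
    | none => trivial
    | some α => exact h _ (mem_lastLetters.2 ⟨α, hf, rfl⟩)
  · obtain ⟨α, hα, rfl⟩ := mem_lastLetters.1 hy
    exact h _ hα
  · cases g with
    | none => exact absurd hg hG
    | some α => exact h _ (mem_lastLetters.2 ⟨α, hg, rfl⟩)

end MarkovWord

open IsToeplitzCuntzKriegerFamily

/-! ### Products of initial projections over words and over letters -/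

section IniExt

variable {𝒢 : Type u} {A : Matrix 𝒢 𝒢 ℤ} {B : Type v} [CStarAlgebra B] {S : MarkovWord A → B}

theorem Semigroupoid.IsRepresentation.iniExt_mul_self {Λ : Type u} [Semigroupoid Λ] {S : Λ → B}
    (hS : Semigroupoid.IsRepresentation S) (f : Option Λ) :
    Semigroupoid.iniExt S f * Semigroupoid.iniExt S f = Semigroupoid.iniExt S f := by
  cases f with
  | none => exact one_mul 1
  | some f => exact (hS.isPartialIsometry f).iniProj_mul_self

theorem commute_iniExt_iniProj {T : 𝒢 → B} (hT : ∀ i j, Commute (iniProj (T i)) (iniProj (T j)))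
    (hST : ∀ α, iniProj (S α) = iniProj (T α.last)) (f : Option (MarkovWord A)) (i : 𝒢) :
    Commute (Semigroupoid.iniExt S f) (iniProj (T i)) := by
  cases f with
  | none => exact Commute.one_left _
  | some α =>
    change Commute (iniProj (S α)) _
    rw [hST]
    exact hT _ _

/-- If `Q_α` depends only on the last letter of `α`, then the product of the `Q_f`, `f ∈ F`, can be
taken over the last letters. -/
theorem noncommProd_iniExt_eq (hS : Semigroupoid.IsRepresentation S) {T : 𝒢 → B}
    (hT : ∀ i, IsPartialIsometry (T i)) (commT : ∀ i j, Commute (iniProj (T i)) (iniProj (T j)))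
    (hST : ∀ α, iniProj (S α) = iniProj (T α.last)) (F : Finset (Option (MarkovWord A)))
    (X : Finset 𝒢) (hX : X = MarkovWord.lastLetters F) (comm) (comm') :
    F.noncommProd (fun f => Semigroupoid.iniExt S f) comm =
      X.noncommProd (fun x => iniProj (T x)) comm' := by
  subst hX
  refine Finset.noncommProd_eq_of_factors _ _ _ _ _ _ (commute_iniExt_iniProj commT hST)
    hS.iniExt_mul_self (fun i => (hT i).iniProj_mul_self) ?_ ?_
  · rintro (_ | α) hα
    · exact Or.inl rfl
    · exact Or.inr ⟨_, MarkovWord.mem_lastLetters.2 ⟨α, hα, rfl⟩, hST α⟩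
  · intro i hi
    obtain ⟨α, hα, rfl⟩ := MarkovWord.mem_lastLetters.1 hi
    exact ⟨_, hα, hST α⟩

theorem noncommProd_one_sub_iniExt_eq (hS : Semigroupoid.IsRepresentation S) {T : 𝒢 → B}
    (hT : ∀ i, IsPartialIsometry (T i)) (commT : ∀ i j, Commute (iniProj (T i)) (iniProj (T j)))
    (hST : ∀ α, iniProj (S α) = iniProj (T α.last)) (G : Finset (Option (MarkovWord A)))
    (hG : none ∉ G) (Y : Finset 𝒢) (hY : Y = MarkovWord.lastLetters G) (comm) (comm') :
    G.noncommProd (fun g => 1 - Semigroupoid.iniExt S g) comm =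
      Y.noncommProd (fun y => 1 - iniProj (T y)) comm' := by
  subst hY
  refine Finset.noncommProd_eq_of_factors _ _ _ _ _ _ (fun f i => ?_)
    (fun f => one_sub_mul_one_sub_self (hS.iniExt_mul_self f))
    (fun i => one_sub_mul_one_sub_self (hT i).iniProj_mul_self) ?_ ?_
  · exact (Commute.one_left _).sub_left
      ((Commute.one_right _).sub_right (commute_iniExt_iniProj commT hST f i))
  · rintro (_ | α) hα
    · exact absurd hα hG
    · exact Or.inr ⟨_, MarkovWord.mem_lastLetters.2 ⟨α, hα, rfl⟩, congrArg (1 - ·) (hST α)⟩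
  · intro i hi
    obtain ⟨α, hα, rfl⟩ := MarkovWord.mem_lastLetters.1 hi
    exact ⟨_, hα, congrArg (1 - ·) (hST α)⟩

end IniExt

/-! ### Tightness of word products -/

namespace IsCuntzKriegerFamily

variable {𝒢 : Type u} {A : Matrix 𝒢 𝒢 ℤ} {B : Type v} [CStarAlgebra B] {S : 𝒢 → B}

/-- Insert Q of the last letter into S_α S_α* and expand it by the Cuntz-Krieger relation with Y =
∅. -/
theorem finProj_wordProd_eq_sum (hS : IsCuntzKriegerFamily A S) (α : MarkovWord A)
    (hfin : {j | matrixEntryProd A {α.last} ∅ j ≠ 0}.Finite) :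
    finProj (wordProd S α) = ∑ j ∈ hfin.toFinset,
      matrixEntryProd A {α.last} ∅ j • (wordProd S α * finProj (S j) * star (wordProd S α)) := by
  have h := ((congrArg₂ (· * ·) (Finset.noncommProd_singleton _ _)
    (Finset.noncommProd_empty _ _)).trans (mul_one _)).symm.trans (hS.prod_ini {α.last} ∅ hfin)
  conv_lhs => rw [finProj, ← hS.wordProd_mul_iniProj α, h]
  -- The rewriting has inserted Q into both factors; it is removed from the adjoint one so that a
  -- single sum remains.
  have h' : star (wordProd S α * iniProj (S α.last)) = star (wordProd S α) := by
    rw [hS.wordProd_mul_iniProj]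
  rw [← h, h', h, Finset.mul_sum, Finset.sum_mul]
  simp only [mul_smul_comm, smul_mul_assoc]

theorem finProj_wordProd_snoc (α : MarkovWord A) (j : 𝒢) (h : A α.last j = 1) :
    finProj (wordProd S (α.snoc j h)) =
      wordProd S α * finProj (S j) * star (wordProd S α) := by
  simp [finProj, wordProd, MarkovWord.letters_snoc, mul_assoc]

/-- If every extension of `α` intersects an element of the finite set `H`, then `P_α` is dominated
by the supremum of the `P_h`, `h ∈ H`. -/
theorem noncommProd_one_sub_mul_finProj (hS : IsCuntzKriegerFamily A S)
    (hA : ∀ i j, A i j = 0 ∨ A i j = 1) (H : Finset (MarkovWord A)) (comm) (n : ℕ) :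
    ∀ α : MarkovWord A, (∀ h ∈ H, h.letters.length < α.letters.length + n) →
      (∀ β : MarkovWord A, α.letters <+: β.letters → ∃ h ∈ H, Semigroupoid.Intersects h β) →
      H.noncommProd (fun h => 1 - finProj (wordProd S h)) comm * finProj (wordProd S α) = 0 := by
  induction n with
  | zero =>
    intro α hlen hcov
    obtain ⟨h, hH, hi⟩ := hcov α List.prefix_rfl
    refine Finset.noncommProd_one_sub_mul_eq_zero H _ comm hH (hS.finProj_mul_finProj_of_prefix ?_)
    refine ((MarkovWord.intersects_iff h α).1 hi).resolve_right fun hp => ?_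
    have := hp.length_le
    have := hlen h hH
    omega
  | succ n ih =>
    intro α hlen hcov
    by_cases hex : ∃ h ∈ H, h.letters <+: α.letters
    · obtain ⟨h, hH, hp⟩ := hex
      exact Finset.noncommProd_one_sub_mul_eq_zero H _ comm hH (hS.finProj_mul_finProj_of_prefix hp)
    push Not at hex
    have hmem : ∀ j, matrixEntryProd A {α.last} ∅ j ≠ 0 ↔ A α.last j = 1 := fun j => by
      rw [matrixEntryProd_ne_zero_iff hA]; simp
    have hfin : {j | matrixEntryProd A {α.last} ∅ j ≠ 0}.Finite := by
      -- No h ∈ H is a prefix of α, so an h meeting αj must extend αj: the letter j is then the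
      -- entry of h at position |α|, and H is finite.
      refine Set.Finite.subset (Set.Finite.preimage (Option.some_injective 𝒢).injOn
        (H.finite_toSet.image fun h => h.letters[α.letters.length]?)) fun j hj => ?_
      have hj' := (hmem j).1 hj
      obtain ⟨h, hH, hi⟩ := hcov (α.snoc j hj') ⟨[j], rfl⟩
      refine ⟨h, hH, ?_⟩
      rw [MarkovWord.intersects_iff, MarkovWord.letters_snoc, List.prefix_concat_iff] at hi
      have hp : α.letters ++ [j] <+: h.letters := by
        rcases hi with (hi | hi) | hi
        · rw [hi]
        · exact absurd hi (hex h hH)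
        · exact hi
      obtain ⟨l, hl⟩ := hp
      simp [← hl]
    rw [hS.finProj_wordProd_eq_sum α hfin, Finset.mul_sum]
    refine Finset.sum_eq_zero fun j hj => ?_
    have hj' := (hmem j).1 (by simpa using hj)
    rw [← finProj_wordProd_snoc α j hj', mul_smul_comm, ih, smul_zero]
    · intro h hH
      have := hlen h hH
      rw [MarkovWord.letters_snoc, List.length_append, List.length_singleton]
      omega
    · intro β hβ
      exact hcov β ((List.prefix_append _ _).trans hβ)

theorem isTight_wordProd (hS : IsCuntzKriegerFamily A S) (hA : ∀ i j, A i j = 0 ∨ A i j = 1) :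
    Semigroupoid.IsTight (wordProd S : MarkovWord A → B) where
  toIsRepresentation := hS.isRepresentation_wordProd hA
  tight F G H hH := by
    have hrep := hS.isRepresentation_wordProd hA
    by_cases hG : none ∈ G
    -- With 1 ∈ G the set Λ^{F,G} is empty and the factor 1 - Q_1 vanishes, so both sides are 0.
    · have hH' : H = ∅ := by
        refine Finset.eq_empty_of_forall_notMem fun h hh => ?_
        exact (hH.1 hh).2 none hG trivial
      subst hH'
      classical
      have hz : ∀ comm, G.noncommProd
          (fun g => 1 - Semigroupoid.iniExt (wordProd S : MarkovWord A → B) g) comm = 0 := by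
        intro comm
        rw [← Finset.mul_noncommProd_erase G hG,
          show 1 - Semigroupoid.iniExt (wordProd S : MarkovWord A → B) none = 0 from sub_self 1,
          zero_mul]
      refine (congrArg (1 - ·) (Finset.noncommProd_empty _ _)).trans ((sub_self 1).trans ?_)
      exact ((congrArg (_ * ·) (hz _)).trans (mul_zero _)).symm
    have hdom := MarkovWord.mem_domainSet_iff F G hG
    simp only [← matrixEntryProd_ne_zero_iff hA] at hdom
    have hfin : {j | matrixEntryProd A (MarkovWord.lastLetters F) (MarkovWord.lastLetters G) j
        ≠ 0}.Finite := by
      -- The one-letter word j lies in Λ^{F,G}, so it meets some h ∈ H, which must begin with j.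
      refine (H.finite_toSet.image MarkovWord.first).subset fun j hj => ?_
      obtain ⟨h, hh, hi⟩ := hH.2 (MarkovWord.single j) ((hdom _).2 hj)
      exact ⟨h, hh, MarkovWord.first_eq_of_intersects hi⟩
    have hsum := (congrArg₂ (· * ·)
      (noncommProd_iniExt_eq hrep hS.isPartialIsometry hS.commute_ini hS.iniProj_wordProd F _ rfl
        (fun f _ g _ _ => hrep.commute_iniExt f g) _)
      (noncommProd_one_sub_iniExt_eq hrep hS.isPartialIsometry hS.commute_ini hS.iniProj_wordProd G
        hG _ rfl (fun f _ g _ _ => hrep.commute_one_sub_iniExt f g) _)).trans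
      (hS.prod_ini _ _ hfin)
    refine Finset.one_sub_noncommProd_one_sub_eq H (fun h => finProj (wordProd S h)) _
      (fun h hh => ?_) ?_
    · have hd := hH.1 hh
      have hcomm : ∀ f, Commute (finProj (wordProd S h))
          (Semigroupoid.iniExt (wordProd S : MarkovWord A → B) f) := by
        rintro (_ | f)
        · exact Commute.one_right _
        · exact (hrep.commute_ini_fin f h).symm
      -- P_h is moved to the right of the product, where each factor fixes it: Q_f P_h = P_h for f ∈
      -- F, and Q_g P_h = 0 for g ∈ G.
      refine (Commute.mul_right (Finset.noncommProd_commute _ _ _ _ fun f _ => hcomm f)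
        (Finset.noncommProd_commute _ _ _ _ fun f _ =>
          (Commute.one_right _).sub_right (hcomm f))).eq.trans ((mul_assoc _ _ _).trans ?_)
      refine (congrArg (_ * ·) (Finset.noncommProd_mul_eq_self _ _ _ ?_)).trans
        (Finset.noncommProd_mul_eq_self _ _ _ ?_)
      rotate_left
      · rintro (_ | f) hf
        · exact one_mul _
        · exact hrep.ini_mul_fin f h (hd.1 _ hf)
      · rintro (_ | g) hg
        · exact absurd hg hG
        · have h₀ : A g.last h.first = 0 := (hA _ _).resolve_right (hd.2 _ hg)
          change (1 - iniProj (wordProd S g)) * _ = _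
          rw [hS.iniProj_wordProd, sub_mul, hS.iniProj_mul_finProj_wordProd, h₀, zero_smul,
            sub_zero, one_mul]
    · rw [hsum, Finset.mul_sum]
      refine Finset.sum_eq_zero fun j hj => ?_
      have hj' : matrixEntryProd A (MarkovWord.lastLetters F) (MarkovWord.lastLetters G) j ≠ 0 := by
        simpa using hj
      have hPj : finProj (S j) = finProj (wordProd S (MarkovWord.single j : MarkovWord A)) := by
        simp [wordProd]
      rw [hPj, mul_smul_comm]
      -- The depth is the maximal length in H; starting from a word of length 1 gives the strict
      -- bound required.
      refine (congrArg (_ • ·) (hS.noncommProd_one_sub_mul_finProj hA H _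
        (H.sup fun h => h.letters.length) _ ?_ ?_)).trans (smul_zero _)
      · intro h hh
        have := Finset.le_sup (f := fun h : MarkovWord A => h.letters.length) hh
        rw [MarkovWord.letters_single, List.length_singleton]
        exact Nat.lt_one_add_iff.2 this
      · intro β hβ
        refine hH.2 β ((hdom β).2 ?_)
        rwa [← (MarkovWord.single_prefix_iff j β).1 hβ]

end IsCuntzKriegerFamily

/-! ### Tight representations give Cuntz-Krieger families -/

namespace Semigroupoid.IsTight

variable {𝒢 : Type u} {A : Matrix 𝒢 𝒢 ℤ} {B : Type v} [CStarAlgebra B] {S : MarkovWord A → B}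

/-- Peel off first letters by multiplicativity: the representation is determined by its values on
letters. -/
theorem wordProd_single (hS : IsTight S) (α : MarkovWord A) :
    wordProd (fun i => S (MarkovWord.single i)) α = S α := by
  obtain ⟨l, h, hl⟩ := α
  induction l with
  | nil => exact absurd rfl h
  | cons i l ih =>
    cases l with
    | nil => simp [wordProd, MarkovWord.single]
    | cons j l =>
      have hl' := List.isChain_cons_cons.1 hl
      have ih' := ih (by simp) hl'.2
      have hm := hS.mul_of_composable (MarkovWord.single i) ⟨j :: l, by simp, hl'.2⟩ hl'.1
      rw [← ih'] at hm
      exact Eq.trans (by simp [wordProd]) hm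

theorem isToeplitzCuntzKriegerFamily (hS : IsTight S) (hA : ∀ i j, A i j = 0 ∨ A i j = 1) :
    IsToeplitzCuntzKriegerFamily A (fun i => S (MarkovWord.single i)) where
  isPartialIsometry i := hS.isPartialIsometry _
  commute_ini i j := hS.commute_ini_ini _ _
  star_mul i j hij := by
    have h := hS.fin_mul_fin_of_disjoint (MarkovWord.single i) (MarkovWord.single j)
      fun h => hij (MarkovWord.first_eq_of_intersects h)
    -- S_i* S_j = S_i* P_i P_j S_j, and distinct letters are disjoint words.
    rw [← (hS.isPartialIsometry (MarkovWord.single i)).star_mul_finProj,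
      ← (hS.isPartialIsometry (MarkovWord.single j)).finProj_mul, mul_assoc,
      ← mul_assoc (finProj _), h, zero_mul, mul_zero]
  ini_mul i j := by
    rcases hA i j with h | h
    · rw [h, zero_smul, iniProj, mul_assoc, hS.mul_of_not_composable, mul_zero]
      intro h'
      rw [MarkovWord.composable_iff, MarkovWord.last_single, MarkovWord.first_single, h] at h'
      exact zero_ne_one h'
    · rw [h, one_smul]
      have h' := hS.ini_mul_fin (MarkovWord.single i) (MarkovWord.single j) h
      conv_lhs => rw [← (hS.isPartialIsometry (MarkovWord.single j)).finProj_mul, ← mul_assoc, h']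
      exact (hS.isPartialIsometry (MarkovWord.single j)).finProj_mul

theorem isCuntzKriegerFamily (hS : IsTight S) (hA : ∀ i j, A i j = 0 ∨ A i j = 1) :
    IsCuntzKriegerFamily A (fun i => S (MarkovWord.single i)) where
  toIsToeplitzCuntzKriegerFamily := hS.isToeplitzCuntzKriegerFamily hA
  prod_ini X Y hfin := by
    classical
    have hT := hS.isToeplitzCuntzKriegerFamily hA
    have hrep := hS.toIsRepresentation
    have hini : ∀ α : MarkovWord A, iniProj (S α) = iniProj (S (MarkovWord.single α.last)) :=
      fun α => by rw [← hT.iniProj_wordProd α, hS.wordProd_single]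
    let toSet : Finset 𝒢 → Finset (Option (MarkovWord A)) :=
      fun X => X.image fun x => some (MarkovWord.single x)
    have hlast : ∀ X, X = MarkovWord.lastLetters (toSet X) := fun X => by
      ext i
      rw [MarkovWord.mem_lastLetters]
      simp only [toSet, Finset.mem_image]
      constructor
      · exact fun hi => ⟨_, ⟨i, hi, rfl⟩, rfl⟩
      · rintro ⟨α, ⟨x, hx, h⟩, rfl⟩
        cases h
        exact hx
    have hnone : none ∉ toSet Y := by simp [toSet]
    have hdom := MarkovWord.mem_domainSet_iff (toSet X) (toSet Y) hnone
    simp only [← hlast, ← matrixEntryProd_ne_zero_iff hA] at hdom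
    have hcov : IsCovering ((hfin.toFinset.image MarkovWord.single : Finset (MarkovWord A)) :
        Set (MarkovWord A)) (domainSet (toSet X) (toSet Y)) := by
      constructor
      · intro h hh
        obtain ⟨j, hj, rfl⟩ := Finset.mem_image.1 (Finset.mem_coe.1 hh)
        exact (hdom _).2 (by simpa using hj)
      · intro β hβ
        refine ⟨MarkovWord.single β.first, ?_, ?_⟩
        · exact Finset.mem_coe.2 (Finset.mem_image_of_mem _ (by simpa using (hdom β).1 hβ))
        · exact (MarkovWord.intersects_iff _ _).2 (Or.inl ((MarkovWord.single_prefix_iff _ _).2 rfl))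
    have ht := hS.tight _ _ _ hcov
    refine (congrArg₂ (· * ·)
      (noncommProd_iniExt_eq hrep hT.isPartialIsometry hT.commute_ini hini (toSet X) X (hlast X) _
        _).symm
      (noncommProd_one_sub_iniExt_eq hrep hT.isPartialIsometry hT.commute_ini hini (toSet Y) hnone Y
        (hlast Y) _ _).symm).trans (ht.symm.trans ?_)
    have hself : ∀ j : 𝒢, finProj (S (MarkovWord.single j)) * finProj (S (MarkovWord.single j)) =
      finProj (S (MarkovWord.single j)) := fun j => (hS.isPartialIsometry _).finProj_mul_self
    -- For orthogonal projections the supremum is the sum; every nonzero coefficient A(X,Y,j) is 1.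
    refine Finset.one_sub_noncommProd_one_sub_eq _ (fun h => finProj (S h)) _ (fun h hh => ?_) ?_
    · obtain ⟨j, hj, rfl⟩ := Finset.mem_image.1 hh
      rw [Finset.mul_sum, Finset.sum_eq_single_of_mem j hj]
      · rw [matrixEntryProd_eq_one hA (by simpa using hj), one_smul, hself]
      · intro k _ hk
        rw [mul_smul_comm, hS.fin_mul_fin_of_disjoint, smul_zero]
        exact fun h => hk (MarkovWord.first_eq_of_intersects h).symm
    · rw [Finset.mul_sum]
      refine Finset.sum_eq_zero fun j hj => ?_
      rw [mul_smul_comm]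
      exact (congrArg (_ • ·) (Finset.noncommProd_one_sub_mul_eq_zero _ (fun h => finProj (S h)) _
        (Finset.mem_image_of_mem _ hj) (hself j))).trans (smul_zero _)

end Semigroupoid.IsTight

/-! ### Maps between universal C*-algebras -/

open scoped CStarAlgebra

namespace PartialIsometryRelations

variable {X Y : Type u} {R : PartialIsometryRelations X} {R' : PartialIsometryRelations Y}

/-- A map from the models of `R'` to those of `R` that keeps the algebra induces a homomorphism
between the products in the opposite direction. -/
noncomputable def productMap (T : ∀ N : R'.Model, X → N.carrier)
    (hT : ∀ N, R.Holds N.carrier (T N)) :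
    R.Product →⋆ₐ[ℂ] R'.Product where
  toFun f := (⟨fun N => f.1 ⟨N.carrier, T N, hT N⟩,
    memℓp_infty (by
      obtain ⟨C, hC⟩ := memℓp_infty_iff.1 f.2
      -- The coordinates of the image are among those of `f`, so the same bound serves.
      refine ⟨C, ?_⟩
      rintro _ ⟨N, rfl⟩
      exact hC ⟨_, rfl⟩)⟩ : lp (fun N : R'.Model => N.carrier) ∞)
  map_one' := rfl
  map_mul' _ _ := rfl
  map_zero' := rfl
  map_add' _ _ := rfl
  commutes' _ := rfl
  map_star' _ := rfl

variable (T : ∀ N : R'.Model, X → N.carrier) (hT : ∀ N, R.Holds N.carrier (T N))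

/-- The preimage of the target subalgebra is a closed *-subalgebra containing the generators. -/
theorem productMap_apply_mem
    (h : ∀ x, productMap T hT (R.productFamily x) ∈ R'.universalSubalgebra) {a : R.Product}
    (ha : a ∈ R.universalSubalgebra) : productMap T hT a ∈ R'.universalSubalgebra := by
  have hle : R.universalSubalgebra ≤ R'.universalSubalgebra.comap (productMap T hT) := by
    refine StarSubalgebra.topologicalClosure_minimal (StarAlgebra.adjoin_le ?_) ?_
    · rintro _ ⟨x, rfl⟩
      exact h x
    · have hc : Continuous (productMap T hT) := map_continuous (productMap T hT)
      exact IsClosed.preimage hc (StarSubalgebra.isClosed_topologicalClosure _)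
  exact hle ha

/-- The restriction of `productMap` to the universal algebras. -/
noncomputable def universalMap
    (h : ∀ x, productMap T hT (R.productFamily x) ∈ R'.universalSubalgebra) :
    R.Universal →⋆ₐ[ℂ] R'.Universal :=
  StarAlgHom.codRestrict ((productMap T hT).comp R.universalSubalgebra.subtype)
    R'.universalSubalgebra fun a => productMap_apply_mem T hT h a.2

/-- Homomorphisms on a universal algebra are determined by their values on the generators. -/
theorem universal_hom_ext {C : Type v} [CStarAlgebra C] {φ ψ : R.Universal →⋆ₐ[ℂ] C}
    (h : ∀ x, φ (R.generator x) = ψ (R.generator x)) : φ = ψ := by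
  have hc (χ : R.Universal →⋆ₐ[ℂ] C) : Continuous χ :=
    (NonUnitalStarAlgHom.instContinuousLinearMapClassComplex
      (F := R.Universal →⋆ₐ[ℂ] C)).map_continuous χ
  refine StarAlgHom.ext_topologicalClosure (hc φ) (hc ψ) ?_
  refine StarAlgHom.ext_adjoin ?_
  rintro ⟨_, _⟩ ⟨x, rfl⟩
  exact h x

end PartialIsometryRelations

/-! ### The isomorphism -/

section Isomorphism

open PartialIsometryRelations IsToeplitzCuntzKriegerFamily

variable {𝒢 : Type u} {A : Matrix 𝒢 𝒢 ℤ}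

/-- The homomorphism `S_α ↦ S_{α₁} ⋯ S_{αₙ}`. -/
noncomputable def semigroupoidToCuntzKrieger (hA : ∀ i j, A i j = 0 ∨ A i j = 1) :
    Semigroupoid.UnitalCStarAlgebra (MarkovWord A) →⋆ₐ[ℂ] UnitalCuntzKriegerAlgebra A :=
  universalMap (R := Semigroupoid.tightRelations (MarkovWord A)) (R' := cuntzKriegerRelations A)
    (fun N α => wordProd N.family α) (fun N => N.holds.isTight_wordProd hA) fun α => by
      -- The image of S_α is a finite product of generators. The induction runs over arbitrary lists
      -- because the tail of a word may be empty.
      have h : ∀ l : List 𝒢, ∃ a ∈ (cuntzKriegerRelations A).universalSubalgebra,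
          ∀ N, a.1 N = (l.map N.family).prod := by
        intro l
        induction l with
        | nil => exact ⟨1, one_mem _, fun N => rfl⟩
        | cons i l ih =>
          obtain ⟨a, ha, hN⟩ := ih
          refine ⟨_, mul_mem ((cuntzKriegerRelations A).generator i).2 ha, fun N => ?_⟩
          rw [List.map_cons, List.prod_cons, ← hN]
          rfl
      obtain ⟨a, ha, hN⟩ := h α.letters
      convert ha
      exact Subtype.ext (funext fun N => (hN N).symm)

/-- The homomorphism `S_x ↦ S_x`. -/
noncomputable def cuntzKriegerToSemigroupoid (hA : ∀ i j, A i j = 0 ∨ A i j = 1) :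
    UnitalCuntzKriegerAlgebra A →⋆ₐ[ℂ] Semigroupoid.UnitalCStarAlgebra (MarkovWord A) :=
  universalMap (R := cuntzKriegerRelations A) (R' := Semigroupoid.tightRelations (MarkovWord A))
    (fun N i => N.family (MarkovWord.single i))
    (fun N => Semigroupoid.IsTight.isCuntzKriegerFamily N.holds hA)
    fun i => ((Semigroupoid.tightRelations (MarkovWord A)).generator (MarkovWord.single i)).2

end Isomorphism

theorem theorem6p2 {𝒢 : Type u} (A : Matrix 𝒢 𝒢 ℤ) (hA : ∀ i j, A i j = 0 ∨ A i j = 1)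
    (hrow : ∀ i, ∃ j, A i j ≠ 0) :
    Nonempty (Semigroupoid.UnitalCStarAlgebra (MarkovWord A) ≃⋆ₐ[ℂ]
      UnitalCuntzKriegerAlgebra A) := by
  refine ⟨StarAlgEquiv.ofStarAlgHom (semigroupoidToCuntzKrieger hA)
    (cuntzKriegerToSemigroupoid hA) ?_ ?_⟩
  · refine PartialIsometryRelations.universal_hom_ext fun α => ?_
    -- Elements of the universal algebra are compared at each model N, where the composite sends S_α
    -- to the product of the S at its letters.
    refine Subtype.ext (Subtype.ext (funext fun N => ?_))
    exact Semigroupoid.IsTight.wordProd_single N.holds α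
  · refine PartialIsometryRelations.universal_hom_ext fun i => ?_
    refine Subtype.ext (Subtype.ext (funext fun N => ?_))
    exact List.prod_singleton
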